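/- Let $(\Omega,\mathcal F,(\mathbb F_n)_{n\in\mathbb N_0},\mathbb P)$ be a filtered probability space (here $\mathbb N=\{1,2,\dots\}$, $\mathbb N_0=\mathbb N\cup\{0\}$). For every $n\in\mathbb N$ let $\gamma_n\colon\Omega\to\mathbb R$ be $\mathbb F_{n-1}$-measurable, and assume $$\mathbb P\Bigl(\limsup_{n\to\infty}\gamma_n=0\Bigr)=\mathbb P\Bigl(\sum_{n=1}^\infty|\gamma_n|=\infty\Bigr)=1$$ and $\mathbb P(\gamma_{n+1}\le\gamma_n)=1$ for all $n\in\mathbb N$. Let $d\in\mathbb N$, $\vartheta\in\mathbb R^d$, let $g\colon\mathbb R^d\to\mathbb R^d$ be measurable and locally bounded, and let $c\in(0,\infty)$ satisfy for all $\theta\in\mathbb R^d$ that $$\langle\theta-\vartheta,g(\theta)\rangle\le-c\,\|\theta-\vartheta\|^2 .$$ Let $\Theta\colon\mathbb N_0\times\Omega\to\mathbb R^d$ be an $(\mathbb F_n)_{n\in\mathbb N_0}$-adapted stochastic process, let $D\colon\mathbb N\times\Omega\to\mathbb R^d$ be an $(\mathbb F_n)_{n\in\mathbb N}$-adapted stochastic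 process with $\mathbb E[\sup_{n\in\mathbb N}\|D_n\|^2]<\infty$, and assume that for all $n\in\mathbb N$ it holds $\mathbb P$-a.s. that $$\Theta_n=\Theta_{n-1}+\gamma_n\,g(\Theta_{n-1})+\gamma_nD_n\qquad\text{and}\qquad\mathbb E[D_n\mid\mathbb F_{n-1}]=0 .$$ For every $t\in[0,\infty)$ let $N_t\colon\Omega\to\mathbb N_0$ satisfy $$N_t=\inf\Bigl\{n\in\mathbb N_0\colon\sum_{k=1}^n\gamma_k\ge t\Bigr\}$$ wherever this set is non-empty (its value elsewhere, on a null set, is arbitrary), and let $\mathcal E=\{\sup_{n\in\mathbb N}\|\Theta_n\|<\infty\}\subseteq\Omega$. Then for every $t\in[0,\infty)$ the expectation below is that of an integrable function, and $$\limsup_{t\to\infty}\mathbb E\bigl[\min\{1,\|\Theta_{N_t}-\vartheta\|\,\mathbf 1_{\mathcal E}\}\bigr]=0 ,$$ that is, $\Theta_{N_t}$ converges in probability to $\vartheta$ as $t\to\infty$ on the event $\mathcal E$. -/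

import Mathlib

open MeasureTheory ProbabilityTheory Filter Topology

/-! The recursion is studied on the time scale T_n = γ_1 + ⋯ + γ_n. Expanding the square and using
coercivity, one step of size γ multiplies ‖Θ - ϑ‖² by at most 1 - 2cγ ≤ exp(-2cγ), up to a term
linear in the noise and an error γ²‖g + D‖². Weighted by exp(2c(T_n - t)), the squared distance
therefore grows only by these two terms (`exp_mul_norm_sq_step_le`).

Each step is localised to an event known at its start: γ_1 ≤ R, all iterates so far bounded by R,
time still before t. There g is bounded by some G, and the linear term has mean zero because the
step sizes are predictable. Hence the second moment of Θ at time N_t, on the event that γ_1 and all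
‖Θ_n‖ are at most R, is at most exp(-2ct)(R + ‖ϑ‖)² + E[2(G² + sup‖D‖²) S_t; γ_1 ≤ R], where S_t is
the discounted sum of squared steps (`lintegral_indicator_stopped_norm_sq_le`).

S_t resembles a Riemann sum of exp(2c(s - t)) over s < t with an extra factor γ → 0, so it is
bounded and vanishes pathwise as t → ∞. Since the steps are random, S_t cannot be pulled out of the
expectation; E[sup‖D‖²] < ∞ supplies the majorant for dominated convergence. Finally, the localising
events cover 𝓔 as R → ∞, and a Chebyshev-type bound concludes. -/

/-- If `W` is nonnegative and `W (n + 1) ≤ W n + Y n` as long as a decreasing `{0, 1}`-valued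
sequence `χ` equals `1`, then the increments summed up to the stopping time dominate `W`. -/
theorem mul_le_add_sum_mul_of_step_le {W Y χ : ℕ → ℝ} (hW : ∀ n, 0 ≤ W n)
    (hχ : ∀ n, χ n = 0 ∨ χ n = 1) (hχ_anti : ∀ n, χ n = 0 → χ (n + 1) = 0)
    (hstep : ∀ n, χ n = 1 → W (n + 1) ≤ W n + Y n) (m : ℕ) :
    χ m * W (m + 1) ≤ χ 0 * W 0 + ∑ n ∈ Finset.range (m + 1), χ n * Y n := by
  induction m with
  | zero =>
    rcases hχ 0 with h | h
    · simp [h]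
    · simpa [h] using hstep 0 h
  | succ m ih =>
    rw [Finset.sum_range_succ, ← add_assoc]
    rcases hχ (m + 1) with h | h
    · have h0 : 0 ≤ χ m * W (m + 1) := by
        rcases hχ m with h' | h' <;> simp [h', hW]
      simp only [h, zero_mul, add_zero]
      exact h0.trans ih
    · have hm : χ m = 1 := (hχ m).resolve_left fun h' => by
        have := hχ_anti m h'
        rw [h] at this
        exact one_ne_zero this
      rw [hm, one_mul] at ih
      rw [h, one_mul, one_mul]
      linarith [hstep (m + 1) h]

theorem add_sum_mul_nonneg_of_step_le {W Y χ : ℕ → ℝ} (hW : ∀ n, 0 ≤ W n)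
    (hχ : ∀ n, χ n = 0 ∨ χ n = 1) (hχ_anti : ∀ n, χ n = 0 → χ (n + 1) = 0)
    (hstep : ∀ n, χ n = 1 → W (n + 1) ≤ W n + Y n) (m : ℕ) :
    0 ≤ χ 0 * W 0 + ∑ n ∈ Finset.range m, χ n * Y n := by
  have hpos : ∀ k n, 0 ≤ χ k * W n := fun k n => by
    rcases hχ k with h | h <;> simp [h, hW]
  cases m with
  | zero => simpa using hpos 0 0
  | succ m => exact (hpos m _).trans (mul_le_add_sum_mul_of_step_le hW hχ hχ_anti hstep m)

/-! ### Discounted sums of step sizes -/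

/-- The partial sums `a 0 + ⋯ + a (n - 1)`. -/
def cumTime (a : ℕ → ℝ) (n : ℕ) : ℝ := ∑ k ∈ Finset.range n, a k

theorem cumTime_succ (a : ℕ → ℝ) (n : ℕ) : cumTime a (n + 1) = cumTime a n + a n :=
  Finset.sum_range_succ _ _

theorem cumTime_mono {a : ℕ → ℝ} (ha : ∀ n, 0 ≤ a n) : Monotone (cumTime a) :=
  monotone_nat_of_le_succ fun n => by rw [cumTime_succ]; linarith [ha n]

/-- The exponentially discounted sum of the squared step sizes used before time `t`. -/
noncomputable def discountedSqSum (l : ℝ) (a : ℕ → ℝ) (t : ℝ) : ENNReal :=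
  ∑' n, ENNReal.ofReal
    (if cumTime a n < t then Real.exp (l * (cumTime a (n + 1) - t)) * a n ^ 2 else 0)

/-- Telescoping: writing T for `cumTime a`, l·a_n ≤ exp(l·a_n) - 1 bounds the n-th term by exp(lK)/l
times the increment of exp(l(T - t)) over the step. A step starting before t ends before t + K, so
the minimum with t + K is inactive while terms are added and caps the bound uniformly in `m`. -/
theorem sum_exp_mul_step_le {l K t : ℝ} {a : ℕ → ℝ} (hl : 0 < l) (ha : ∀ n, 0 ≤ a n)
    (haK : ∀ n, a n ≤ K) (m : ℕ) :
    ∑ n ∈ Finset.range m,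
      (if cumTime a n < t then Real.exp (l * (cumTime a (n + 1) - t)) * a n else 0) ≤
      Real.exp (l * K) / l * Real.exp (l * (min (cumTime a m) (t + K) - t)) := by
  have hK : 0 ≤ K := (ha 0).trans (haK 0)
  induction m with
  | zero => simp only [Finset.range_zero, Finset.sum_empty]; positivity
  | succ m ih =>
    rw [Finset.sum_range_succ]
    split_ifs with h
    · have h1 : cumTime a (m + 1) ≤ t + K := by rw [cumTime_succ]; linarith [haK m]
      rw [min_eq_left (by linarith : cumTime a m ≤ t + K)] at ih
      rw [min_eq_left h1]
      set x := Real.exp (l * (cumTime a m - t)) with hx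
      have hx0 : 0 < x := Real.exp_pos _
      have h2 : Real.exp (l * (cumTime a (m + 1) - t)) = x * Real.exp (l * a m) := by
        rw [hx, ← Real.exp_add, cumTime_succ]; ring_nf
      have h3 : Real.exp (l * a m) ≤ Real.exp (l * K) :=
        Real.exp_le_exp.2 (mul_le_mul_of_nonneg_left (haK m) hl.le)
      have h4 : l * a m ≤ Real.exp (l * a m) - 1 := by linarith [Real.add_one_le_exp (l * a m)]
      have h5 : x * Real.exp (l * a m) * a m ≤
          Real.exp (l * K) / l * (x * (Real.exp (l * a m) - 1)) := by
        have e1 : Real.exp (l * K) / l * (x * (l * a m)) = x * Real.exp (l * K) * a m := by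
          field_simp
        calc x * Real.exp (l * a m) * a m ≤ x * Real.exp (l * K) * a m := by
              have := ha m
              gcongr
          _ = Real.exp (l * K) / l * (x * (l * a m)) := e1.symm
          _ ≤ _ := by gcongr
      rw [h2]
      calc _ ≤ Real.exp (l * K) / l * x +
            Real.exp (l * K) / l * (x * (Real.exp (l * a m) - 1)) := add_le_add ih h5
        _ = _ := by ring
    · rw [add_zero]
      refine ih.trans ?_
      have := cumTime_mono ha (Nat.le_succ m)
      gcongr

theorem sum_exp_mul_step_le_const {l K t : ℝ} {a : ℕ → ℝ} (hl : 0 < l) (ha : ∀ n, 0 ≤ a n)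
    (haK : ∀ n, a n ≤ K) (m : ℕ) :
    ∑ n ∈ Finset.range m,
      (if cumTime a n < t then Real.exp (l * (cumTime a (n + 1) - t)) * a n else 0) ≤
      Real.exp (l * K) / l * Real.exp (l * K) := by
  refine (sum_exp_mul_step_le hl ha haK m).trans ?_
  gcongr
  linarith [min_le_right (cumTime a m) (t + K)]

theorem discountedSqSum_le {l K : ℝ} {a : ℕ → ℝ} (hl : 0 < l) (ha : ∀ n, 0 ≤ a n)
    (haK : ∀ n, a n ≤ K) (t : ℝ) :
    discountedSqSum l a t ≤ ENNReal.ofReal (K * (Real.exp (l * K) / l * Real.exp (l * K))) := by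
  have hK : 0 ≤ K := (ha 0).trans (haK 0)
  refine ENNReal.tsum_le_of_sum_range_le fun m => ?_
  rw [← ENNReal.ofReal_sum_of_nonneg (fun n _ => by split_ifs <;> positivity)]
  refine ENNReal.ofReal_le_ofReal ?_
  refine le_trans ?_ (mul_le_mul_of_nonneg_left
    (sum_exp_mul_step_le_const (t := t) hl ha haK m) hK)
  rw [Finset.mul_sum]
  refine Finset.sum_le_sum fun n _ => ?_
  split_ifs
  · have := mul_le_mul_of_nonneg_left (haK n)
      (mul_nonneg (Real.exp_pos (l * (cumTime a (n + 1) - t))).le (ha n))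
    linarith
  · simp

/-- Split at an index n₀ beyond which a_n ≤ ε/(2B). The finitely many earlier terms are killed by
the discount; in the later ones, one factor a_n is replaced by ε/(2B) and the remaining sum is at
most B. -/
theorem tendsto_discountedSqSum {l K : ℝ} {a : ℕ → ℝ} (hl : 0 < l) (ha : ∀ n, 0 ≤ a n)
    (haK : ∀ n, a n ≤ K) (ha_lim : Tendsto a atTop (𝓝 0)) :
    Tendsto (discountedSqSum l a) atTop (𝓝 0) := by
  set B := Real.exp (l * K) / l * Real.exp (l * K) with hB
  have hB0 : 0 < B := by positivity
  have key : ∀ ε : ℝ, 0 < ε → ∀ᶠ t in atTop, discountedSqSum l a t ≤ ENNReal.ofReal ε := by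
    intro ε hε
    have hδ : 0 < ε / 2 / B := by positivity
    obtain ⟨n₀, hn₀⟩ := eventually_atTop.1 (ha_lim.eventually_le_const hδ)
    have hlim : Tendsto (fun t => ∑ n ∈ Finset.range n₀,
        Real.exp (l * (cumTime a (n + 1) - t)) * a n ^ 2) atTop (𝓝 0) := by
      rw [← Finset.sum_const_zero (s := Finset.range n₀)]
      refine tendsto_finsetSum _ fun n _ => ?_
      have : Tendsto (fun t : ℝ => l * (cumTime a (n + 1) - t)) atTop atBot :=
        (tendsto_atBot_add_const_left _ _ tendsto_neg_atTop_atBot).const_mul_atBot hl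
      simpa using (Real.tendsto_exp_atBot.comp this).mul_const (a n ^ 2)
    filter_upwards [hlim.eventually_le_const (half_pos hε)] with t ht
    refine ENNReal.tsum_le_of_sum_range_le fun m => ?_
    rw [← ENNReal.ofReal_sum_of_nonneg (fun n _ => by split_ifs <;> positivity)]
    refine ENNReal.ofReal_le_ofReal ?_
    have hterm : ∀ n, (if cumTime a n < t then
        Real.exp (l * (cumTime a (n + 1) - t)) * a n ^ 2 else 0) ≤
        (if n < n₀ then Real.exp (l * (cumTime a (n + 1) - t)) * a n ^ 2 else 0) +
        ε / 2 / B * (if cumTime a n < t then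
          Real.exp (l * (cumTime a (n + 1) - t)) * a n else 0) := by
      intro n
      have hp := (Real.exp_pos (l * (cumTime a (n + 1) - t))).le
      have hpa := mul_nonneg hp (ha n)
      by_cases h1 : cumTime a n < t <;> by_cases h2 : n < n₀ <;> simp only [h1, h2, if_true, if_false]
      · have := mul_nonneg hδ.le hpa
        linarith
      · have := mul_le_mul_of_nonneg_left (hn₀ n (not_lt.1 h2)) hpa
        linarith
      · positivity
      · simp
    calc _ ≤ _ := Finset.sum_le_sum fun n (_ : n ∈ Finset.range m) => hterm n
      _ = (∑ n ∈ Finset.range m,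
            if n < n₀ then Real.exp (l * (cumTime a (n + 1) - t)) * a n ^ 2 else 0) +
          ε / 2 / B * ∑ n ∈ Finset.range m, (if cumTime a n < t then
            Real.exp (l * (cumTime a (n + 1) - t)) * a n else 0) := by
          rw [Finset.sum_add_distrib, Finset.mul_sum]
      _ ≤ ε / 2 + ε / 2 / B * B := by
          refine add_le_add (le_trans ?_ ht)
            (mul_le_mul_of_nonneg_left (sum_exp_mul_step_le_const hl ha haK m) hδ.le)
          rw [← Finset.sum_filter]
          refine Finset.sum_le_sum_of_subset_of_nonneg (fun n hn => ?_) fun n _ _ => by positivity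
          simpa using (Finset.mem_filter.1 hn).2
      _ = ε := by field_simp; norm_num
  refine ENNReal.tendsto_nhds_zero.2 fun ε hε => ?_
  by_cases hε' : ε = ⊤
  · simp [hε']
  · filter_upwards [key ε.toReal (ENNReal.toReal_pos hε.ne' hε')] with t ht
    rwa [ENNReal.ofReal_toReal hε'] at ht

/-! ### One-step estimate and vanishing noise term -/

theorem exists_bound_of_forall_nhds_isBounded_image {X Y : Type*} [TopologicalSpace X]
    [SeminormedAddCommGroup Y] {g : X → Y}
    (hg : ∀ x, ∃ U ∈ 𝓝 x, Bornology.IsBounded (g '' U)) {s : Set X} (hs : IsCompact s) :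
    ∃ G : ℝ, ∀ x ∈ s, ‖g x‖ ≤ G := by
  have : Bornology.IsBounded (g '' s) := by
    refine hs.induction_on (p := fun t => Bornology.IsBounded (g '' t)) (by simp)
      (fun s t hst ht => ht.subset (Set.image_mono hst)) (fun s t h1 h2 => ?_) fun x _ => ?_
    · rw [Set.image_union]; exact h1.union h2
    · obtain ⟨U, hU, h⟩ := hg x
      exact ⟨U, mem_nhdsWithin_of_mem_nhds hU, h⟩
  obtain ⟨G, hG⟩ := this.exists_norm_le
  exact ⟨G, fun x hx => hG _ (Set.mem_image_of_mem g hx)⟩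

theorem norm_add_smul_sub_sq_le {F : Type*} [NormedAddCommGroup F] [InnerProductSpace ℝ F]
    {x y v w : F} {c r : ℝ} (hr : 0 ≤ r) (hv : inner ℝ (x - y) v ≤ -c * ‖x - y‖ ^ 2) :
    ‖x + r • v + r • w - y‖ ^ 2 ≤
      (1 - 2 * c * r) * ‖x - y‖ ^ 2 + 2 * r * inner ℝ (x - y) w + r ^ 2 * ‖v + w‖ ^ 2 := by
  have e : x + r • v + r • w - y = (x - y) + r • (v + w) := by rw [smul_add]; abel
  rw [e, norm_add_sq_real, inner_smul_right, inner_add_right, norm_smul, mul_pow,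
    Real.norm_eq_abs, sq_abs]
  nlinarith [mul_le_mul_of_nonneg_left hv hr]

/-- The exponential weight absorbs the contraction, since 1 - 2cr ≤ exp(-2cr). The scalar stays
inside the first slot of the inner product, so that the whole slot can serve as a predictable
factor. -/
theorem exp_mul_norm_sq_step_le {F : Type*} [NormedAddCommGroup F] [InnerProductSpace ℝ F]
    {x y v w : F} {c r s : ℝ} (hr : 0 ≤ r) (hv : inner ℝ (x - y) v ≤ -c * ‖x - y‖ ^ 2) :
    Real.exp (2 * c * (s + r)) * ‖x + r • v + r • w - y‖ ^ 2 ≤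
      Real.exp (2 * c * s) * ‖x - y‖ ^ 2 +
        (inner ℝ ((2 * Real.exp (2 * c * (s + r)) * r) • (x - y)) w +
          Real.exp (2 * c * (s + r)) * r ^ 2 * ‖v + w‖ ^ 2) := by
  have h1 := mul_le_mul_of_nonneg_left (norm_add_smul_sub_sq_le (w := w) hr hv)
    (Real.exp_pos (2 * c * (s + r))).le
  have h2 : Real.exp (2 * c * (s + r)) * (1 - 2 * c * r) ≤ Real.exp (2 * c * s) := by
    have h3 : 1 - 2 * c * r ≤ Real.exp (-(2 * c * r)) := by
      linarith [Real.add_one_le_exp (-(2 * c * r))]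
    calc _ ≤ Real.exp (2 * c * (s + r)) * Real.exp (-(2 * c * r)) := by gcongr
      _ = _ := by rw [← Real.exp_add]; ring_nf
  have h4 := mul_le_mul_of_nonneg_right h2 (sq_nonneg ‖x - y‖)
  rw [real_inner_smul_left]
  linarith

theorem integral_inner_eq_zero_of_condExp_eq_zero {Ω F : Type*} {m mΩ : MeasurableSpace Ω}
    {P : Measure Ω} [IsProbabilityMeasure P] [NormedAddCommGroup F] [InnerProductSpace ℝ F]
    [CompleteSpace F] (hm : m ≤ mΩ) {X Y : Ω → F} (hY : StronglyMeasurable[m] Y)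
    (hX : Integrable X P) (hYX : Integrable (fun ω => inner ℝ (Y ω) (X ω)) P)
    (hce : P[X | m] =ᵐ[P] 0) : ∫ ω, inner ℝ (Y ω) (X ω) ∂P = 0 := by
  have h : P[fun ω => inner ℝ (Y ω) (X ω) | m] =ᵐ[P] fun ω => inner ℝ (Y ω) ((P[X | m]) ω) :=
    condExp_bilin_of_stronglyMeasurable_left (innerSL ℝ) hY hYX hX
  rw [← integral_condExp hm, integral_congr_ae h]
  rw [← integral_zero Ω ℝ (μ := P)]
  refine integral_congr_ae ?_
  filter_upwards [hce] with ω hω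
  simp [hω]

/-! ### Localised second moment at the stopping index -/

theorem lintegral_indicator_stopped_norm_sq_le {Ω F : Type*} {mΩ : MeasurableSpace Ω}
    [NormedAddCommGroup F] [InnerProductSpace ℝ F] [CompleteSpace F] [SecondCountableTopology F]
    [MeasurableSpace F] [BorelSpace F]
    {P : Measure Ω} [IsProbabilityMeasure P] {𝔽 : Filtration ℕ mΩ} {a : ℕ → Ω → ℝ}
    (ha : ∀ n, Measurable[𝔽 n] (a n)) (ha_nonneg : ∀ᵐ ω ∂P, ∀ n, 0 ≤ a n ω)
    (ha_le : ∀ᵐ ω ∂P, ∀ n, a n ω ≤ a 0 ω) {y : F} {g : F → F} (hg : Measurable g)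
    {R G : ℝ} (hgG : ∀ x, ‖x‖ ≤ R → ‖g x‖ ≤ G) {c : ℝ} (hc : 0 < c)
    (hgc : ∀ x, inner ℝ (x - y) (g x) ≤ -c * ‖x - y‖ ^ 2) {Θ D : ℕ → Ω → F}
    (hΘ : ∀ n, Measurable[𝔽 n] (Θ n)) (hD : ∀ n, Measurable[𝔽 (n + 1)] (D n))
    (hD_sup : ∫⁻ ω, ⨆ n, ‖D n ω‖ₑ ^ 2 ∂P < ⊤)
    (hrec : ∀ᵐ ω ∂P, ∀ n, Θ (n + 1) ω = Θ n ω + a n ω • g (Θ n ω) + a n ω • D n ω)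
    (hce : ∀ n, P[D n | 𝔽 n] =ᵐ[P] 0) {t : ℝ} (ht : 0 < t) {N : Ω → ℕ}
    (hN : ∀ᵐ ω ∂P, IsLeast {n | t ≤ cumTime (fun k => a k ω) n} (N ω)) :
    ∫⁻ ω, {ω | a 0 ω ≤ R ∧ ∀ n, ‖Θ n ω‖ ≤ R}.indicator
        (fun ω => ENNReal.ofReal (‖Θ (N ω) ω - y‖ ^ 2)) ω ∂P ≤
      ENNReal.ofReal (Real.exp (-(2 * c * t)) * (R + ‖y‖) ^ 2) +
        ∫⁻ ω, 2 * (ENNReal.ofReal (G ^ 2) + ⨆ n, ‖D n ω‖ₑ ^ 2) *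
          {ω | a 0 ω ≤ R}.indicator (fun ω => discountedSqSum (2 * c) (fun k => a k ω) t) ω ∂P := by
  set T : ℕ → Ω → ℝ := fun n ω => cumTime (fun k => a k ω) n with hT
  have hTs : ∀ n ω, T (n + 1) ω = T n ω + a n ω := fun n ω => cumTime_succ _ _
  have hT_meas : ∀ n, Measurable[𝔽 n] (T n) := fun n =>
    Finset.measurable_fun_sum _ fun k hk =>
      (ha k).mono (𝔽.mono (Finset.mem_range.1 hk).le) le_rfl
  -- Predictability: T_{n+1} is already known at time n, so the weight `e (n + 1)` may multiply `D
  -- n` without spoiling the zero mean.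
  have hTs_meas : ∀ n, Measurable[𝔽 n] (T (n + 1)) := fun n => by
    have : T (n + 1) = fun ω => T n ω + a n ω := funext (hTs n)
    rw [this]; exact (hT_meas n).add (ha n)
  -- The event that step n is still performed: it is decided at time n and decreases in n.
  set C : ℕ → Set Ω := fun n => {ω | a 0 ω ≤ R ∧ T n ω < t ∧ ∀ k ≤ n, ‖Θ k ω‖ ≤ R} with hC
  have hC_meas : ∀ n, MeasurableSet[𝔽 n] (C n) := fun n => by
    have e : C n = {ω | a 0 ω ≤ R} ∩ ({ω | T n ω < t} ∩ ⋂ k, ⋂ (_ : k ≤ n), {ω | ‖Θ k ω‖ ≤ R}) := by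
      ext ω; simp [hC]
    rw [e]
    have h1 : Measurable[𝔽 n] (a 0) := (ha 0).mono (𝔽.mono (Nat.zero_le n)) le_rfl
    refine @MeasurableSet.inter _ (𝔽 n) _ _ (h1 measurableSet_Iic)
      (@MeasurableSet.inter _ (𝔽 n) _ _ (hT_meas n measurableSet_Iio)
      (@MeasurableSet.iInter _ _ (𝔽 n) _ _ fun k => @MeasurableSet.iInter _ _ (𝔽 n) _ _ fun hk => ?_))
    exact (measurable_norm.comp ((hΘ k).mono (𝔽.mono hk) le_rfl)) measurableSet_Iic
  have hC_meas' : ∀ n, MeasurableSet (C n) := fun n => 𝔽.le n _ (hC_meas n)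
  set e : ℕ → Ω → ℝ := fun n ω => Real.exp (2 * c * (T n ω - t)) with he
  set W : ℕ → Ω → ℝ := fun n ω => e n ω * ‖Θ n ω - y‖ ^ 2 with hW
  set Y : ℕ → Ω → F := fun n => (C n).indicator
    fun ω => (2 * e (n + 1) ω * a n ω) • (Θ n ω - y) with hY
  set Q : ℕ → Ω → ℝ := fun n => (C n).indicator
    fun ω => e (n + 1) ω * a n ω ^ 2 * ‖g (Θ n ω) + D n ω‖ ^ 2 with hQ
  set W₀ : Ω → ℝ := (C 0).indicator (W 0) with hW₀
  set X : ℕ → Ω → ℝ := fun m ω =>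
    W₀ ω + ∑ n ∈ Finset.range m, (inner ℝ (Y n ω) (D n ω) + Q n ω) with hX
  -- measurability
  have ha' : ∀ n, Measurable (a n) := fun n => (ha n).mono (𝔽.le n) le_rfl
  have hΘ' : ∀ n, Measurable (Θ n) := fun n => (hΘ n).mono (𝔽.le n) le_rfl
  have hD' : ∀ n, Measurable (D n) := fun n => (hD n).mono (𝔽.le _) le_rfl
  have hT' : ∀ n, Measurable (T n) := fun n => (hT_meas n).mono (𝔽.le n) le_rfl
  have hes_meas : ∀ n, Measurable[𝔽 n] (e (n + 1)) := fun n =>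
    Real.measurable_exp.comp (((hTs_meas n).sub_const t).const_mul (2 * c))
  have he' : ∀ n, Measurable (e n) := fun n =>
    Real.measurable_exp.comp (((hT' n).sub_const t).const_mul (2 * c))
  have hY_meas : ∀ n, Measurable[𝔽 n] (Y n) := fun n =>
    Measurable.indicator ((((hes_meas n).const_mul 2).mul (ha n)).smul
      ((hΘ n).sub_const y)) (hC_meas n)
  have hY' : ∀ n, Measurable (Y n) := fun n => (hY_meas n).mono (𝔽.le n) le_rfl
  have hQ' : ∀ n, Measurable (Q n) := fun n =>
    Measurable.indicator (((he' (n + 1)).mul ((ha' n).pow_const 2)).mul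
      (((hg.comp (hΘ' n)).add (hD' n)).norm.pow_const 2)) (hC_meas' n)
  have hW₀' : Measurable W₀ :=
    Measurable.indicator ((he' 0).mul (((hΘ' 0).sub_const y).norm.pow_const 2)) (hC_meas' 0)
  have hX' : ∀ m, Measurable (X m) := fun m =>
    hW₀'.add (Finset.measurable_fun_sum _ fun n _ => ((hY' n).inner (hD' n)).add (hQ' n))
  -- integrability
  have hD_L2 : ∀ n, MemLp (D n) 2 P := fun n => by
    refine ⟨(hD' n).aestronglyMeasurable, ?_⟩
    rw [eLpNorm_lt_top_iff_lintegral_rpow_enorm_lt_top (by norm_num) (by norm_num)]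
    refine lt_of_le_of_lt (lintegral_mono fun ω => ?_) hD_sup
    have : ‖D n ω‖ₑ ^ (2 : ENNReal).toReal = ‖D n ω‖ₑ ^ 2 := by
      rw [← ENNReal.rpow_natCast]; norm_num
    rw [this]
    exact le_iSup (fun n => ‖D n ω‖ₑ ^ 2) n
  have hD_int : ∀ n, Integrable (D n) P := fun n => (hD_L2 n).integrable (by norm_num)
  have hD_sq : ∀ n, Integrable (fun ω => ‖D n ω‖ ^ 2) P := fun n => (hD_L2 n).norm.integrable_sq
  -- A step starting before t overshoots it by at most a_n ≤ a_0 ≤ R.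
  have he_bd : ∀ᵐ ω ∂P, ∀ n, ω ∈ C n → e (n + 1) ω ≤ Real.exp (2 * c * R) := by
    filter_upwards [ha_le] with ω h1 n hn
    refine Real.exp_le_exp.2 (mul_le_mul_of_nonneg_left ?_ (by positivity))
    rw [hTs]
    linarith [h1 n, hn.1, hn.2.1]
  -- The absolute value keeps the bound nonnegative even when `R` is negative.
  have hY_bd : ∀ n, ∀ᵐ ω ∂P, ‖Y n ω‖ ≤ |2 * Real.exp (2 * c * R) * R * (R + ‖y‖)| := fun n => by
    filter_upwards [ha_le, ha_nonneg, he_bd] with ω h1 h2 h3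
    by_cases hω : ω ∈ C n
    · rw [hY]
      simp only [Set.indicator_of_mem hω]
      have h4 := h3 n hω
      have h5 := (h1 n).trans hω.1
      have h6 : ‖Θ n ω - y‖ ≤ R + ‖y‖ :=
        (norm_sub_le _ _).trans (by linarith [hω.2.2 n le_rfl])
      have h7 := h2 n
      have h8 : 0 < e (n + 1) ω := Real.exp_pos _
      have h9 : 0 ≤ R := h7.trans h5
      rw [norm_smul, Real.norm_of_nonneg (by positivity)]
      refine le_trans ?_ (le_abs_self _)
      gcongr
    · simp only [hY, Set.indicator_of_notMem hω, norm_zero]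
      positivity
  have hYD_int : ∀ n, Integrable (fun ω => inner ℝ (Y n ω) (D n ω)) P := fun n => by
    refine ((hD_int n).norm.const_mul |2 * Real.exp (2 * c * R) * R * (R + ‖y‖)|).mono'
      ((hY' n).inner (hD' n)).aestronglyMeasurable ?_
    filter_upwards [hY_bd n] with ω hω
    exact (norm_inner_le_norm _ _).trans (by gcongr)
  have hQ_nonneg : ∀ n ω, 0 ≤ Q n ω := fun n ω =>
    Set.indicator_nonneg (fun ω _ => by positivity) ω
  have hgD : ∀ n, ∀ ω ∈ C n, ‖g (Θ n ω) + D n ω‖ ^ 2 ≤ 2 * (G ^ 2 + ‖D n ω‖ ^ 2) := by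
    intro n ω hω
    have h1 := hgG _ (hω.2.2 n le_rfl)
    have h2 := norm_add_le (g (Θ n ω)) (D n ω)
    have h3 := norm_nonneg (g (Θ n ω))
    calc _ ≤ (G + ‖D n ω‖) ^ 2 := by gcongr; linarith
      _ ≤ _ := by nlinarith [sq_nonneg (G - ‖D n ω‖)]
  have hQ_int : ∀ n, Integrable (Q n) P := fun n => by
    refine (((integrable_const (G ^ 2)).add (hD_sq n)).const_mul
      (Real.exp (2 * c * R) * R ^ 2 * 2)).mono' (hQ' n).aestronglyMeasurable ?_
    filter_upwards [ha_le, ha_nonneg, he_bd] with ω h1 h2 h3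
    rw [Real.norm_of_nonneg (hQ_nonneg n ω)]
    by_cases hω : ω ∈ C n
    · rw [hQ]
      simp only [Set.indicator_of_mem hω, Pi.add_apply]
      have h4 := h3 n hω
      have h5 := (h1 n).trans hω.1
      have h7 := h2 n
      rw [mul_assoc _ 2]
      exact mul_le_mul (by gcongr) (hgD n ω hω) (by positivity) (by positivity)
    · simp only [hQ, Set.indicator_of_notMem hω, Pi.add_apply]
      positivity
  have hW₀_bd : ∀ ω, W₀ ω ≤ Real.exp (-(2 * c * t)) * (R + ‖y‖) ^ 2 := fun ω => by
    by_cases hω : ω ∈ C 0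
    · have h6 : ‖Θ 0 ω - y‖ ≤ R + ‖y‖ :=
        (norm_sub_le _ _).trans (by linarith [hω.2.2 0 le_rfl])
      have h7 : e 0 ω = Real.exp (-(2 * c * t)) := by
        simp [he, hT, cumTime]
      rw [hW₀, Set.indicator_of_mem hω, hW]
      simp only [h7]
      gcongr
    · rw [hW₀, Set.indicator_of_notMem hω]; positivity
  have hW₀_nonneg : ∀ ω, 0 ≤ W₀ ω := fun ω => Set.indicator_nonneg (fun ω _ => by positivity) ω
  have hW₀_int : Integrable W₀ P :=
    (integrable_const _).mono' hW₀'.aestronglyMeasurable (ae_of_all _ fun ω => by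
      rw [Real.norm_of_nonneg (hW₀_nonneg ω)]; exact hW₀_bd ω)
  have hX_int : ∀ m, Integrable (X m) P := fun m =>
    hW₀_int.add (integrable_finsetSum _ fun n _ => (hYD_int n).add (hQ_int n))
  have hX_integral : ∀ m, ∫ ω, X m ω ∂P = ∫ ω, W₀ ω ∂P + ∑ n ∈ Finset.range m, ∫ ω, Q n ω ∂P := by
    intro m
    have hsum : ∀ n, Integrable (fun ω => inner ℝ (Y n ω) (D n ω) + Q n ω) P :=
      fun n => (hYD_int n).add (hQ_int n)
    rw [hX]
    simp only
    rw [integral_add hW₀_int (integrable_finsetSum _ fun n _ => hsum n),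
      integral_finsetSum _ fun n _ => hsum n]
    congr 1
    refine Finset.sum_congr rfl fun n _ => ?_
    rw [integral_add (hYD_int n) (hQ_int n), integral_inner_eq_zero_of_condExp_eq_zero (𝔽.le n)
      (hY_meas n).stronglyMeasurable (hD_int n) (hYD_int n) (hce n), zero_add]
  -- pathwise comparison
  have hpath : ∀ᵐ ω ∂P, (∀ m, 0 ≤ X m ω) ∧ (ω ∈ {ω | a 0 ω ≤ R ∧ ∀ n, ‖Θ n ω‖ ≤ R} →
      ∀ m ≥ N ω, ‖Θ (N ω) ω - y‖ ^ 2 ≤ X m ω) := by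
    filter_upwards [ha_nonneg, hrec, hN] with ω h1 h2 h3
    have hmono : Monotone (cumTime fun k => a k ω) := cumTime_mono h1
    set χ : ℕ → ℝ := fun n => (C n).indicator 1 ω with hχ
    set Z : ℕ → ℝ := fun n => inner ℝ ((2 * e (n + 1) ω * a n ω) • (Θ n ω - y)) (D n ω) +
      e (n + 1) ω * a n ω ^ 2 * ‖g (Θ n ω) + D n ω‖ ^ 2 with hZ
    have hXχ : ∀ m, X m ω = χ 0 * W 0 ω + ∑ n ∈ Finset.range m, χ n * Z n := fun m => by
      simp only [hX, hχ, hW₀, hY, hQ]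
      congr 1
      · by_cases hω : ω ∈ C 0 <;> simp [hω]
      · refine Finset.sum_congr rfl fun n _ => ?_
        by_cases hω : ω ∈ C n <;> simp [hω, hZ]
    have hWn : ∀ n, 0 ≤ W n ω := fun n => by positivity
    have hχ01 : ∀ n, χ n = 0 ∨ χ n = 1 := fun n => by
      by_cases hω : ω ∈ C n <;> simp [hχ, hω]
    have hχa : ∀ n, χ n = 0 → χ (n + 1) = 0 := fun n hn => by
      have hω : ω ∉ C n := fun hω => by simp [hχ, hω] at hn
      have hω' : ω ∉ C (n + 1) := fun h => hω
        ⟨h.1, (hmono (Nat.le_succ n)).trans_lt h.2.1, fun k hk => h.2.2 k (hk.trans n.le_succ)⟩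
      simp [hχ, hω']
    have hstep : ∀ n, χ n = 1 → W (n + 1) ω ≤ W n ω + Z n := fun n _ => by
      have := exp_mul_norm_sq_step_le (w := D n ω) (s := T n ω - t) (h1 n) (hgc (Θ n ω))
      rw [← h2 n, sub_add_eq_add_sub, ← hTs] at this
      exact this
    refine ⟨fun m => ?_, fun hA m hm => ?_⟩
    · rw [hXχ]
      exact add_sum_mul_nonneg_of_step_le hWn hχ01 hχa hstep m
    · have hmem : ∀ n, n < N ω → ω ∈ C n := fun n hn =>
        ⟨hA.1, not_le.1 fun h => (h3.2 h).not_gt hn, fun k _ => hA.2 k⟩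
      have hnot : ∀ n, N ω ≤ n → χ n = 0 := fun n hn => by
        have : ω ∉ C n := fun h => (h3.1.trans (hmono hn)).not_gt h.2.1
        simp [hχ, this]
      -- As t > 0 and the empty sum is 0, the stopping index is positive; its last active step is k.
      obtain ⟨k, hk⟩ : ∃ k, N ω = k + 1 := Nat.exists_eq_succ_of_ne_zero fun h0 => by
        have := h3.1
        rw [h0] at this
        simp [cumTime] at this
        linarith
      have hXN : X m ω = X (N ω) ω := by
        rw [hXχ, hXχ]
        congr 1
        refine (Finset.sum_subset (Finset.range_mono hm) fun n _ hn => ?_).symm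
        rw [hnot n (by simpa using hn), zero_mul]
      have h5 := mul_le_add_sum_mul_of_step_le hWn hχ01 hχa hstep k
      rw [← hk, ← hXχ, ← hXN] at h5
      have h6 : χ k = 1 := by simp [hχ, hmem k (by omega)]
      rw [h6, one_mul] at h5
      refine le_trans ?_ h5
      -- At the stopping index the accumulated time has reached t, so the weight is at least 1 and
      -- can be dropped.
      have h7 : (1 : ℝ) ≤ e (N ω) ω :=
        Real.one_le_exp (mul_nonneg (by positivity) (sub_nonneg.2 h3.1))
      exact le_mul_of_one_le_left (by positivity) h7
  -- the bound on the expectations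
  have hbound : ∀ m, ∫⁻ ω, ENNReal.ofReal (X m ω) ∂P ≤
      ENNReal.ofReal (Real.exp (-(2 * c * t)) * (R + ‖y‖) ^ 2) +
        ∫⁻ ω, 2 * (ENNReal.ofReal (G ^ 2) + ⨆ n, ‖D n ω‖ₑ ^ 2) *
          {ω | a 0 ω ≤ R}.indicator
            (fun ω => discountedSqSum (2 * c) (fun k => a k ω) t) ω ∂P := by
    intro m
    rw [← ofReal_integral_eq_lintegral_ofReal (hX_int m) (hpath.mono fun ω h => h.1 m),
      hX_integral, ENNReal.ofReal_add (integral_nonneg hW₀_nonneg)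
        (Finset.sum_nonneg fun n _ => integral_nonneg (hQ_nonneg n)),
      ENNReal.ofReal_sum_of_nonneg fun n _ => integral_nonneg (hQ_nonneg n)]
    refine add_le_add (ENNReal.ofReal_le_ofReal ?_) ?_
    · refine (integral_mono hW₀_int (integrable_const _) hW₀_bd).trans ?_
      simp
    · simp_rw [fun n => ofReal_integral_eq_lintegral_ofReal (hQ_int n) (ae_of_all _ (hQ_nonneg n))]
      rw [← lintegral_finsetSum _ fun n _ => (hQ' n).ennreal_ofReal]
      refine lintegral_mono fun ω => ?_
      by_cases hω : a 0 ω ≤ R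
      · rw [Set.indicator_of_mem (s := {ω | a 0 ω ≤ R}) hω, discountedSqSum, ← ENNReal.tsum_mul_left]
        refine le_trans (Finset.sum_le_sum fun n _ => ?_) (ENNReal.sum_le_tsum _)
        by_cases hn : ω ∈ C n
        · rw [if_pos hn.2.1]
          simp only [hQ, Set.indicator_of_mem hn]
          rw [mul_comm (e (n + 1) ω * a n ω ^ 2), ENNReal.ofReal_mul (by positivity)]
          gcongr
          refine (ENNReal.ofReal_le_ofReal (hgD n ω hn)).trans ?_
          rw [ENNReal.ofReal_mul (by norm_num), ENNReal.ofReal_add (by positivity) (by positivity),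
            ENNReal.ofReal_ofNat, ENNReal.ofReal_pow (norm_nonneg (D n ω)), ofReal_norm]
          gcongr
          exact le_iSup (fun n => ‖D n ω‖ₑ ^ 2) n
        · simp [hQ, hn]
      · have : ∀ n, Q n ω = 0 := fun n => Set.indicator_of_notMem (fun h => hω h.1) _
        simp [this]
  -- N is unbounded in ω, so no single m serves all paths. Each path of X is constant from N on, and
  -- Fatou's lemma transfers the bound uniform in m.
  calc _ ≤ ∫⁻ ω, liminf (fun m => ENNReal.ofReal (X m ω)) atTop ∂P := by
        refine lintegral_mono_ae (hpath.mono fun ω h => ?_)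
        by_cases hω : ω ∈ {ω | a 0 ω ≤ R ∧ ∀ n, ‖Θ n ω‖ ≤ R}
        · rw [Set.indicator_of_mem hω]
          refine le_liminf_of_le (by isBoundedDefault) ?_
          filter_upwards [eventually_ge_atTop (N ω)] with m hm
          exact ENNReal.ofReal_le_ofReal (h.2 hω m hm)
        · rw [Set.indicator_of_notMem hω]; exact zero_le
    _ ≤ liminf (fun m => ∫⁻ ω, ENNReal.ofReal (X m ω) ∂P) atTop :=
        lintegral_liminf_le fun m => (hX' m).ennreal_ofReal
    _ ≤ _ := by
        refine (liminf_le_liminf (Eventually.of_forall hbound)).trans ?_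
        simp

/-! ### Step-size limits, measurability and dominated convergence -/

theorem nonneg_and_tendsto_zero_of_antitone_of_limsup_eq_zero {u : ℕ → ℝ} (hu : Antitone u)
    (hlim : limsup (fun n => (u n : EReal)) atTop = 0) :
    (∀ n, 0 ≤ u n) ∧ Tendsto u atTop (𝓝 0) := by
  have hanti : Antitone fun n => (u n : EReal) := fun m n h => EReal.coe_le_coe_iff.2 (hu h)
  have ht := tendsto_atTop_iInf hanti
  rw [← ht.limsup_eq, hlim] at ht
  refine ⟨fun n => ?_, EReal.tendsto_coe.1 ht⟩
  exact_mod_cast hanti.le_of_tendsto ht n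

theorem exists_le_cumTime {a : ℕ → ℝ} (ha : ∀ n, 0 ≤ a n)
    (hsum : ∑' n, ENNReal.ofReal |a n| = ⊤) (t : ℝ) : ∃ n, t ≤ cumTime a n := by
  by_contra! h
  have : ∑' n, ENNReal.ofReal |a n| ≤ ENNReal.ofReal t := by
    refine ENNReal.tsum_le_of_sum_range_le fun m => ?_
    rw [← ENNReal.ofReal_sum_of_nonneg fun n _ => abs_nonneg _]
    refine ENNReal.ofReal_le_ofReal ?_
    simp_rw [fun n => abs_of_nonneg (ha n)]
    exact (h m).le
  rw [hsum] at this
  exact ENNReal.ofReal_ne_top (top_le_iff.1 this)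

theorem aemeasurable_of_ae_isLeast {Ω : Type*} {mΩ : MeasurableSpace Ω} {P : Measure Ω}
    {T : ℕ → Ω → ℝ} (hT : ∀ n, Measurable (T n)) {t : ℝ} {N : Ω → ℕ}
    (hN : ∀ᵐ ω ∂P, IsLeast {n | t ≤ T n ω} (N ω)) : AEMeasurable N P := by
  -- N is arbitrary on a null set; off it, N = n is the measurable event that the sums first reach t
  -- at n.
  refine NullMeasurable.aemeasurable fun s _ => ?_
  have h1 : ∀ n, MeasurableSet {ω | t ≤ T n ω ∧ ∀ m < n, T m ω < t} := fun n => by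
    have e : {ω | t ≤ T n ω ∧ ∀ m < n, T m ω < t} =
        {ω | t ≤ T n ω} ∩ ⋂ m, ⋂ (_ : m < n), {ω | T m ω < t} := by ext; simp
    rw [e]
    exact (measurableSet_le measurable_const (hT n)).inter (MeasurableSet.iInter fun m =>
      MeasurableSet.iInter fun _ => measurableSet_lt (hT m) measurable_const)
  have h2 : MeasurableSet (⋃ n ∈ s, {ω | t ≤ T n ω ∧ ∀ m < n, T m ω < t}) :=
    MeasurableSet.biUnion s.to_countable fun n _ => h1 n
  refine h2.nullMeasurableSet.congr ?_
  filter_upwards [hN] with ω hω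
  apply propext
  change ω ∈ (⋃ n ∈ s, {ω | t ≤ T n ω ∧ ∀ m < n, T m ω < t}) ↔ N ω ∈ s
  simp only [Set.mem_iUnion, Set.mem_ofPred_eq, exists_prop]
  constructor
  · rintro ⟨n, hn, h, h'⟩
    have : N ω = n := le_antisymm (hω.2 h) (not_lt.1 fun hlt => (h' _ hlt).not_ge hω.1)
    rwa [this]
  · exact fun h => ⟨N ω, h, hω.1, fun m hm => not_le.1 fun h' => (hω.2 h').not_gt hm⟩

theorem aemeasurable_apply_of_aemeasurable_nat {Ω F : Type*} {mΩ : MeasurableSpace Ω}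
    [MeasurableSpace F] {P : Measure Ω} {f : ℕ → Ω → F} (hf : ∀ n, Measurable (f n)) {N : Ω → ℕ}
    (hN : AEMeasurable N P) : AEMeasurable (fun ω => f (N ω) ω) P :=
  (measurable_from_prod_countable_right (f := fun p : ℕ × Ω => f p.1 p.2) hf).comp_aemeasurable
    (hN.prodMk aemeasurable_id)

theorem measurable_discountedSqSum {Ω : Type*} {mΩ : MeasurableSpace Ω} {a : ℕ → Ω → ℝ}
    (ha : ∀ n, Measurable (a n)) (l t : ℝ) :
    Measurable fun ω => discountedSqSum l (fun k => a k ω) t := by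
  have hT : ∀ n, Measurable fun ω => cumTime (fun k => a k ω) n := fun n =>
    Finset.measurable_fun_sum _ fun k _ => ha k
  refine Measurable.tsum fun n => Measurable.ennreal_ofReal (Measurable.ite
    (measurableSet_lt (hT n) measurable_const) (Measurable.mul (Real.measurable_exp.comp
      (((hT (n + 1)).sub_const t).const_mul l)) ((ha n).pow_const 2)) measurable_const)

theorem tendsto_lintegral_mul_discountedSqSum {Ω : Type*} {mΩ : MeasurableSpace Ω}
    {P : Measure Ω} {a : ℕ → Ω → ℝ} (ha : ∀ n, Measurable (a n))
    (ha_nonneg : ∀ᵐ ω ∂P, ∀ n, 0 ≤ a n ω) (ha_le : ∀ᵐ ω ∂P, ∀ n, a n ω ≤ a 0 ω)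
    (ha_lim : ∀ᵐ ω ∂P, Tendsto (fun n => a n ω) atTop (𝓝 0)) {l : ℝ} (hl : 0 < l) (R : ℝ)
    {S : Ω → ENNReal} (hS : Measurable S) (hS_int : ∫⁻ ω, S ω ∂P ≠ ⊤) :
    Tendsto (fun t => ∫⁻ ω, S ω *
      {ω | a 0 ω ≤ R}.indicator (fun ω => discountedSqSum l (fun k => a k ω) t) ω ∂P)
      atTop (𝓝 0) := by
  have hset : MeasurableSet {ω | a 0 ω ≤ R} := measurableSet_le (ha 0) measurable_const
  set B := ENNReal.ofReal (R * (Real.exp (l * R) / l * Real.exp (l * R))) with hB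
  have hS_fin : ∀ᵐ ω ∂P, S ω < ⊤ := ae_lt_top hS hS_int
  rw [← lintegral_zero (μ := P)]
  refine tendsto_lintegral_filter_of_dominated_convergence (fun ω => S ω * B)
    (Eventually.of_forall fun t => hS.mul ((measurable_discountedSqSum ha l t).indicator hset))
    (Eventually.of_forall fun t => ?_) ?_ ?_
  · filter_upwards [ha_nonneg, ha_le] with ω h1 h2
    gcongr
    by_cases hω : a 0 ω ≤ R
    · rw [Set.indicator_of_mem (s := {ω | a 0 ω ≤ R}) hω]
      exact discountedSqSum_le hl h1 (fun n => (h2 n).trans hω) t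
    · rw [Set.indicator_of_notMem (s := {ω | a 0 ω ≤ R}) hω]
      exact zero_le
  · rw [lintegral_mul_const _ hS]
    exact ENNReal.mul_ne_top hS_int ENNReal.ofReal_ne_top
  · filter_upwards [ha_nonneg, ha_le, ha_lim, hS_fin] with ω h1 h2 h3 h4
    by_cases hω : a 0 ω ≤ R
    · simp only [Set.indicator_of_mem (s := {ω | a 0 ω ≤ R}) hω]
      simpa using ENNReal.Tendsto.const_mul
        (tendsto_discountedSqSum hl h1 (fun n => (h2 n).trans hω) h3) (Or.inr h4.ne)
    · simp only [Set.indicator_of_notMem (s := {ω | a 0 ω ≤ R}) hω, mul_zero]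
      exact tendsto_const_nhds

/-- Chebyshev's inequality in pointwise form: it turns second-moment decay into convergence of the
truncated expectation. -/
theorem min_one_le_add_inv_mul_sq {x ε : ℝ} (hε : 0 < ε) : min 1 x ≤ ε + ε⁻¹ * x ^ 2 := by
  refine (min_le_right _ _).trans ?_
  have h : x - ε ≤ ε⁻¹ * x ^ 2 := by
    rw [inv_mul_eq_div, le_div_iff₀ hε]
    nlinarith [sq_nonneg (x - ε)]
  linarith

/-! ### Removal of the localisation -/

theorem mainTheorem4 {Ω : Type*} {mΩ : MeasurableSpace Ω}
    (P : Measure Ω) [IsProbabilityMeasure P] (𝔽 : Filtration ℕ mΩ)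
    -- learning rates `γ n`, `n ≥ 1` (the value at `n = 0` is never used)
    (γ : ℕ → Ω → ℝ)
    (hγ_previsible : ∀ n : ℕ, Measurable[𝔽 n] (γ (n + 1)))
    (hγ_limsup : ∀ᵐ ω ∂P, limsup (fun n : ℕ => (γ n ω : EReal)) atTop = 0)
    (hγ_sum : ∀ᵐ ω ∂P, ∑' n : ℕ, ENNReal.ofReal |γ (n + 1) ω| = ⊤)
    (hγ_anti : ∀ n : ℕ, 1 ≤ n → ∀ᵐ ω ∂P, γ (n + 1) ω ≤ γ n ω)
    (d : ℕ) (ϑ : EuclideanSpace ℝ (Fin d))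
    (g : EuclideanSpace ℝ (Fin d) → EuclideanSpace ℝ (Fin d))
    (hg_meas : Measurable g)
    (hg_locBdd : ∀ θ, ∃ U ∈ 𝓝 θ, Bornology.IsBounded (g '' U))
    (c : ℝ) (hc : 0 < c)
    (hg_coercive : ∀ θ, inner ℝ (θ - ϑ) (g θ) ≤ -c * ‖θ - ϑ‖ ^ 2)
    (Θ : ℕ → Ω → EuclideanSpace ℝ (Fin d))
    (hΘ_adapted : ∀ n : ℕ, Measurable[𝔽 n] (Θ n))
    -- error terms `D n`, `n ≥ 1` (the value at `n = 0` is never used)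
    (D : ℕ → Ω → EuclideanSpace ℝ (Fin d))
    (hD_adapted : ∀ n : ℕ, 1 ≤ n → Measurable[𝔽 n] (D n))
    (hD_sup : ∫⁻ ω, ⨆ n : ℕ, ‖D (n + 1) ω‖ₑ ^ 2 ∂P < ⊤)
    (hΘ_rec : ∀ n : ℕ, ∀ᵐ ω ∂P,
      Θ (n + 1) ω = Θ n ω + γ (n + 1) ω • g (Θ n ω) + γ (n + 1) ω • D (n + 1) ω)
    (hD_condExp : ∀ n : ℕ, P[D (n + 1) | 𝔽 n] =ᵐ[P] 0)
    -- `N t ω` is the least `n` with `t ≤ γ 1 ω + ⋯ + γ n ω`; where there is no such `n`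
    -- (which happens only on a null set), the value is arbitrary
    (N : ℝ → Ω → ℕ)
    (hN : ∀ t : ℝ, 0 ≤ t → ∀ ω,
      {n : ℕ | t ≤ ∑ k ∈ Finset.Icc 1 n, γ k ω}.Nonempty →
        IsLeast {n : ℕ | t ≤ ∑ k ∈ Finset.Icc 1 n, γ k ω} (N t ω))
    (E : Set Ω) (hE : E = {ω | ⨆ n : ℕ, ‖Θ (n + 1) ω‖ₑ < ⊤}) :
    (∀ t : ℝ, 0 ≤ t →
      Integrable (fun ω => min 1 (E.indicator (fun ω => ‖Θ (N t ω) ω - ϑ‖) ω)) P) ∧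
    limsup (fun t : ℝ =>
      ((∫ ω, min 1 (E.indicator (fun ω => ‖Θ (N t ω) ω - ϑ‖) ω) ∂P : ℝ) : EReal)) atTop = 0 := by
  set a : ℕ → Ω → ℝ := fun n => γ (n + 1) with ha
  have ha_meas : ∀ n, Measurable (a n) := fun n => (hγ_previsible n).mono (𝔽.le n) le_rfl
  have hΘ' : ∀ n, Measurable (Θ n) := fun n => (hΘ_adapted n).mono (𝔽.le n) le_rfl
  have hT_meas : ∀ n, Measurable fun ω => cumTime (fun k => a k ω) n := fun n =>
    Finset.measurable_fun_sum _ fun k _ => ha_meas k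
  have hT_eq : ∀ n ω, cumTime (fun k => a k ω) n = ∑ k ∈ Finset.Icc 1 n, γ k ω := fun n ω => by
    induction n with
    | zero => simp [cumTime]
    | succ n ih => rw [cumTime_succ, ih, Finset.sum_Icc_succ_top (by omega)]
  have ha_anti : ∀ᵐ ω ∂P, Antitone fun n => a n ω := by
    filter_upwards [ae_all_iff.2 fun n => hγ_anti (n + 1) (by omega)] with ω h
    exact antitone_nat_of_succ_le h
  have ha_zero : ∀ᵐ ω ∂P, (∀ n, 0 ≤ a n ω) ∧ Tendsto (fun n => a n ω) atTop (𝓝 0) := by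
    filter_upwards [ha_anti, hγ_limsup] with ω h1 h2
    refine nonneg_and_tendsto_zero_of_antitone_of_limsup_eq_zero h1 ?_
    rw [← h2]
    exact limsup_nat_add (fun n => (γ n ω : EReal)) 1
  have ha_nonneg : ∀ᵐ ω ∂P, ∀ n, 0 ≤ a n ω := ha_zero.mono fun ω h => h.1
  have ha_le : ∀ᵐ ω ∂P, ∀ n, a n ω ≤ a 0 ω := ha_anti.mono fun ω h n => h (Nat.zero_le n)
  have hN' : ∀ t : ℝ, 0 ≤ t →
      ∀ᵐ ω ∂P, IsLeast {n | t ≤ cumTime (fun k => a k ω) n} (N t ω) := fun t ht => by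
    filter_upwards [ha_nonneg, hγ_sum] with ω h1 h2
    have h3 := exists_le_cumTime h1 h2 t
    simp_rw [hT_eq] at h3 ⊢
    exact hN t ht ω h3
  have hE_meas : MeasurableSet E := by
    rw [hE]
    exact measurableSet_lt (Measurable.iSup fun n => (hΘ' (n + 1)).enorm) measurable_const
  have hf_meas : ∀ t : ℝ, 0 ≤ t → AEMeasurable
      (fun ω => min 1 (E.indicator (fun ω => ‖Θ (N t ω) ω - ϑ‖) ω)) P := fun t ht =>
    aemeasurable_const.min (((aemeasurable_apply_of_aemeasurable_nat hΘ'
      (aemeasurable_of_ae_isLeast hT_meas (hN' t ht))).sub_const ϑ).norm.indicator hE_meas)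
  have hf_nonneg : ∀ t ω, 0 ≤ min 1 (E.indicator (fun ω => ‖Θ (N t ω) ω - ϑ‖) ω) := fun t ω =>
    le_min zero_le_one (Set.indicator_nonneg (fun _ _ => norm_nonneg _) ω)
  have hf_int : ∀ t : ℝ, 0 ≤ t → Integrable
      (fun ω => min 1 (E.indicator (fun ω => ‖Θ (N t ω) ω - ϑ‖) ω)) P := fun t ht =>
    (integrable_const (1 : ℝ)).mono' (hf_meas t ht).aestronglyMeasurable (ae_of_all _ fun ω => by
      rw [Real.norm_of_nonneg (hf_nonneg t ω)]; exact min_le_left _ _)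
  refine ⟨hf_int, ?_⟩
  set A : ℕ → Set Ω := fun R => {ω | a 0 ω ≤ R ∧ ∀ n, ‖Θ n ω‖ ≤ R} with hA
  have hA_meas : ∀ R, MeasurableSet (A R) := fun R => by
    have e : A R = {ω | a 0 ω ≤ R} ∩ ⋂ n, {ω | ‖Θ n ω‖ ≤ R} := by ext; simp [hA]
    rw [e]
    exact (measurableSet_le (ha_meas 0) measurable_const).inter
      (MeasurableSet.iInter fun n => measurableSet_le (hΘ' n).norm measurable_const)
  have hA_mono : Monotone A := fun R R' h ω hω =>
    have h' : (R : ℝ) ≤ R' := by exact_mod_cast h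
    ⟨hω.1.trans h', fun n => (hω.2 n).trans h'⟩
  have hEA : ⋂ R, E \ A R = ∅ := by
    rw [← Set.sdiff_iUnion, Set.sdiff_eq_empty]
    intro ω hω
    rw [hE] at hω
    -- Membership in E controls Θ_n only for n ≥ 1, so ‖Θ_0‖ enters separately, as does the first
    -- step size.
    obtain ⟨R, hR⟩ := exists_nat_ge (max (a 0 ω) (max ‖Θ 0 ω‖
      (⨆ n, ‖Θ (n + 1) ω‖ₑ).toReal))
    refine Set.mem_iUnion.2 ⟨R, (le_max_left _ _).trans hR, fun n => ?_⟩
    have hR' := (le_max_right _ _).trans hR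
    cases n with
    | zero => exact (le_max_left _ _).trans hR'
    | succ n =>
      refine le_trans ?_ ((le_max_right _ _).trans hR')
      rw [← toReal_enorm]
      exact ENNReal.toReal_mono (ne_of_lt hω) (le_iSup (fun n => ‖Θ (n + 1) ω‖ₑ) n)
  have hEA_lim : Tendsto (fun R => P (E \ A R)) atTop (𝓝 0) := by
    have := tendsto_measure_iInter_atTop (μ := P) (s := fun R => E \ A R)
      (fun R => (hE_meas.diff (hA_meas R)).nullMeasurableSet)
      (fun R R' h => Set.sdiff_subset_sdiff_right (hA_mono h)) ⟨0, measure_ne_top _ _⟩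
    rwa [hEA, measure_empty] at this
  have hV : ∀ R : ℕ, Tendsto (fun t => ∫⁻ ω, (A R).indicator
      (fun ω => ENNReal.ofReal (‖Θ (N t ω) ω - ϑ‖ ^ 2)) ω ∂P) atTop (𝓝 0) := fun R => by
    obtain ⟨G, hG⟩ := exists_bound_of_forall_nhds_isBounded_image hg_locBdd
      (isCompact_closedBall (0 : EuclideanSpace ℝ (Fin d)) (R : ℝ))
    have hS_meas : Measurable fun ω =>
        2 * (ENNReal.ofReal (G ^ 2) + ⨆ n : ℕ, ‖D (n + 1) ω‖ₑ ^ 2) :=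
      (measurable_const.add (Measurable.iSup fun n =>
        (((hD_adapted (n + 1) (by omega)).mono (𝔽.le _) le_rfl).enorm.pow_const 2))).const_mul 2
    have hS_int : ∫⁻ ω, 2 * (ENNReal.ofReal (G ^ 2) + ⨆ n : ℕ, ‖D (n + 1) ω‖ₑ ^ 2) ∂P ≠ ⊤ := by
      rw [lintegral_const_mul' _ _ (by norm_num), lintegral_add_left measurable_const]
      refine ENNReal.mul_ne_top (by norm_num) (ENNReal.add_ne_top.2 ⟨?_, hD_sup.ne⟩)
      simp
    have h1 := tendsto_lintegral_mul_discountedSqSum ha_meas ha_nonneg ha_le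
      (ha_zero.mono fun ω h => h.2) (l := 2 * c) (by positivity) R hS_meas hS_int
    have h2 : Tendsto (fun t : ℝ => ENNReal.ofReal (Real.exp (-(2 * c * t)) * (R + ‖ϑ‖) ^ 2))
        atTop (𝓝 0) := by
      have h3 : Tendsto (fun t : ℝ => -(2 * c * t)) atTop atBot :=
        tendsto_neg_atTop_atBot.comp (tendsto_id.const_mul_atTop (by positivity))
      simpa using ENNReal.tendsto_ofReal
        ((Real.tendsto_exp_atBot.comp h3).mul_const ((R + ‖ϑ‖) ^ 2))
    refine tendsto_of_tendsto_of_tendsto_of_le_of_le' tendsto_const_nhds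
      (by simpa using h2.add h1) (Eventually.of_forall fun _ => zero_le) ?_
    filter_upwards [eventually_gt_atTop 0] with t ht
    exact lintegral_indicator_stopped_norm_sq_le hγ_previsible ha_nonneg ha_le hg_meas
      (fun x hx => hG x (by simpa using hx)) hc hg_coercive hΘ_adapted
      (fun n => hD_adapted (n + 1) (by omega)) hD_sup (ae_all_iff.2 hΘ_rec) hD_condExp ht
      (hN' t ht.le)
  -- The truncation at 1 pays for E \ A_R; on A_R the pointwise Chebyshev bound applies.
  have hf_le : ∀ (R : ℕ) (ε : ℝ), 0 < ε → ∀ t ω,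
      ENNReal.ofReal (min 1 (E.indicator (fun ω => ‖Θ (N t ω) ω - ϑ‖) ω)) ≤
        (E \ A R).indicator 1 ω + (ENNReal.ofReal ε + ENNReal.ofReal ε⁻¹ * (A R).indicator
          (fun ω => ENNReal.ofReal (‖Θ (N t ω) ω - ϑ‖ ^ 2)) ω) := fun R ε hε t ω => by
    by_cases h1 : ω ∈ E
    · by_cases h2 : ω ∈ A R
      · rw [Set.indicator_of_mem h1, Set.indicator_of_mem h2,
          ← ENNReal.ofReal_mul (by positivity), ← ENNReal.ofReal_add hε.le (by positivity)]
        exact (ENNReal.ofReal_le_ofReal (min_one_le_add_inv_mul_sq hε)).trans le_add_self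
      · rw [Set.indicator_of_mem (show ω ∈ E \ A R from ⟨h1, h2⟩)]
        refine le_trans ?_ le_self_add
        exact ENNReal.ofReal_le_one.2 (min_le_left _ _)
    · simp [h1]
  have hlint : Tendsto (fun t => ∫⁻ ω,
      ENNReal.ofReal (min 1 (E.indicator (fun ω => ‖Θ (N t ω) ω - ϑ‖) ω)) ∂P) atTop (𝓝 0) := by
    have key : ∀ ε : ℝ, 0 < ε → ∀ᶠ t in atTop, ∫⁻ ω,
        ENNReal.ofReal (min 1 (E.indicator (fun ω => ‖Θ (N t ω) ω - ϑ‖) ω)) ∂P ≤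
          ENNReal.ofReal ε + (ENNReal.ofReal ε + ENNReal.ofReal ε) := by
      intro ε hε
      have hε' := ENNReal.ofReal_pos.2 hε
      obtain ⟨R, hR⟩ := (hEA_lim.eventually_le_const hε').exists
      have h1 : Tendsto (fun t => ENNReal.ofReal ε⁻¹ * ∫⁻ ω, (A R).indicator
          (fun ω => ENNReal.ofReal (‖Θ (N t ω) ω - ϑ‖ ^ 2)) ω ∂P) atTop (𝓝 0) := by
        simpa using ENNReal.Tendsto.const_mul (hV R) (Or.inr (ENNReal.ofReal_ne_top (r := ε⁻¹)))
      filter_upwards [h1.eventually_le_const hε'] with t ht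
      refine (lintegral_mono (hf_le R ε hε t)).trans ?_
      have hm : MeasurableSet (E \ A R) := hE_meas.diff (hA_meas R)
      rw [lintegral_add_left (measurable_one.indicator hm), lintegral_add_left measurable_const,
        lintegral_const_mul' _ _ ENNReal.ofReal_ne_top, lintegral_indicator_one hm,
        lintegral_const, measure_univ, mul_one]
      gcongr
    refine ENNReal.tendsto_nhds_zero.2 fun δ hδ => ?_
    obtain ⟨ε, hε, hεδ⟩ : ∃ ε : ℝ, 0 < ε ∧
        ENNReal.ofReal ε + (ENNReal.ofReal ε + ENNReal.ofReal ε) ≤ δ := by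
      by_cases h : δ = ⊤
      · exact ⟨1, one_pos, h ▸ le_top⟩
      · have hpos := ENNReal.toReal_pos hδ.ne' h
        refine ⟨δ.toReal / 3, by positivity, ?_⟩
        rw [← ENNReal.ofReal_add (by positivity) (by positivity),
          ← ENNReal.ofReal_add (by positivity) (by positivity)]
        refine ENNReal.ofReal_le_of_le_toReal (le_of_eq ?_)
        ring
    exact (key ε hε).mono fun t ht => ht.trans hεδ
  have hreal : Tendsto (fun t => ∫ ω, min 1 (E.indicator (fun ω => ‖Θ (N t ω) ω - ϑ‖) ω) ∂P)
      atTop (𝓝 0) := by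
    refine ((ENNReal.tendsto_toReal ENNReal.zero_ne_top).comp hlint).congr' ?_
    filter_upwards [eventually_ge_atTop 0] with t ht
    exact (integral_eq_lintegral_of_nonneg_ae (ae_of_all _ (hf_nonneg t))
      (hf_int t ht).aestronglyMeasurable).symm
  exact (EReal.tendsto_coe.2 hreal).limsup_eq
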